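/- **Definitions.** All matrices are complex; $\circ$ is the entrywise (Schur) product, $M^{(-)}$ the entrywise inverse of a matrix $M$ without zero entries, and $e_i$ the $i$-th standard basis vector. For $n\times n$ matrices $A,B$ let $X_A(M)=AM$ and $\Delta_B(M)=B\circ M$ on the space of $n\times n$ matrices. $(A,B)$ is a *one-sided Jones pair* if $X_A\Delta_BX_A=\Delta_BX_A\Delta_B$, and a *Jones pair* if both $(A,B)$ and $(A,B^T)$ are one-sided Jones pairs. A Jones pair is *invertible* if $A$ and $B$ are invertible matrices and $B$ has no zero entry (then $A$ has no zero entry either). For a square matrix $A$ without zero entries, the *Nomura algebra* $\mathcal N_A$ is the set of the matrices $M$ such that $Ae_i\circ A^{(-)}e_j$ is an eigenvector of $M$ for all $i,j$. An *association scheme* on a finite set $V$ is a finite set $\mathcal A$ of non-zero $01$-matrices indexed by $V\times V$ that contains $I$, sums to the all-ones matrix $J$, is closed under transposition, and whose members commute pairwise and have their products in the span of $\mathcal A$; this span is its *Bose–Mesner algebra*, and it determines $\mathcal A$. For a non-empty $Y\subseteq V$ let $M_Y$ be the submatrix of $M$ with rows and columns in $Y$, and $\mathcal A_Y$ the set of the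 non-zero matrices among the $M_Y$, $M\in\mathcal A$. If $\mathcal A_Y$ is an association scheme, it is called the *induced scheme* of $\mathcal A$ on $Y$. **Theorem.** Let $n\ge 1$ and let $(A,B)$ be an invertible Jones pair of $n\times n$ matrices. Then there is an invertible diagonal matrix $C$ with $A^T=C^{-2}AC^2$, and for every such $C$ the following holds for the $2n\times 2n$ matrix $$W=\begin{pmatrix}A^T&-A^T\\ (B^{(-)})^TC&(B^{(-)})^TC\end{pmatrix}.$$ $\mathcal N_W$ is the Bose–Mesner algebra of an association scheme $\mathcal A$ on $\{1,\dots,2n\}$, $\mathcal N_A$ is the Bose–Mesner algebra of an association scheme $\mathcal B$ on $\{1,\dots,n\}$, and $\mathcal B$ is the induced scheme of $\mathcal A$ on $Y=\{1,\dots,n\}$, that is, $\mathcal B=\mathcal A_Y$. -/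

import Mathlib

namespace JonesPairs

open Matrix

/-- The Schur inverse `A⁽⁻⁾`, the entrywise inverse of a matrix. -/
noncomputable def schurInv {m n : Type*} (A : Matrix m n ℂ) : Matrix m n ℂ :=
  Matrix.of fun i j => (A i j)⁻¹

/-- A matrix is Schur invertible if it has no zero entry. -/
def IsSchurInvertible {m n : Type*} (A : Matrix m n ℂ) : Prop :=
  ∀ i j, A i j ≠ 0

section JonesPair

variable {n : Type*} [Fintype n]

/-- The endomorphism `X_A : M ↦ A M` of the space of square matrices. -/
def X (A : Matrix n n ℂ) (M : Matrix n n ℂ) : Matrix n n ℂ := A * M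

/-- The endomorphism `Δ_B : M ↦ B ∘ M` (Schur product) of the space of square matrices. -/
def Delta (B : Matrix n n ℂ) (M : Matrix n n ℂ) : Matrix n n ℂ := B ⊙ M

/-- `(A, B)` is a one-sided Jones pair if `X_A Δ_B X_A = Δ_B X_A Δ_B`. -/
def IsOneSidedJonesPair (A B : Matrix n n ℂ) : Prop :=
  X A ∘ Delta B ∘ X A = Delta B ∘ X A ∘ Delta B

/-- `(A, B)` is a Jones pair if `(A, B)` and `(A, Bᵀ)` are one-sided Jones pairs. -/
def IsJonesPair (A B : Matrix n n ℂ) : Prop :=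
  IsOneSidedJonesPair A B ∧ IsOneSidedJonesPair A Bᵀ

/-- An invertible Jones pair: `X_A` and `Δ_B` are invertible, that is, `A` is invertible and `B` is
Schur invertible, and moreover `B` is an invertible matrix. The last condition excludes degenerate
pairs such as `(I, J)`; together these conditions force `A` to be Schur invertible too. -/
structure IsInvertibleJonesPair [DecidableEq n] (A B : Matrix n n ℂ) : Prop where
  isJonesPair : IsJonesPair A B
  isUnit_left : IsUnit A
  schurInvertible_right : IsSchurInvertible B
  isUnit_right : IsUnit B

/-- The space `N_{A,B}` of the matrices that have all the vectors `A e_i ∘ B e_j`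
as eigenvectors. -/
def nomuraPair (A B : Matrix n n ℂ) : Submodule ℂ (Matrix n n ℂ) where
  carrier := {M | ∀ i j, ∃ μ : ℂ, M *ᵥ (fun k => A k i * B k j) = μ • fun k => A k i * B k j}
  zero_mem' := fun i j => ⟨0, by simp⟩
  add_mem' := by
    intro M N hM hN i j
    obtain ⟨μ, hμ⟩ := hM i j
    obtain ⟨ν, hν⟩ := hN i j
    exact ⟨μ + ν, by rw [Matrix.add_mulVec, hμ, hν, add_smul]⟩
  smul_mem' := by
    intro c M hM i j
    obtain ⟨μ, hμ⟩ := hM i j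
    exact ⟨c * μ, by rw [Matrix.smul_mulVec, hμ, mul_smul]⟩

/-- The Nomura algebra `N_A` of the matrices that have all the vectors `A e_i ∘ A⁽⁻⁾ e_j`
as eigenvectors. -/
noncomputable def nomura (A : Matrix n n ℂ) : Submodule ℂ (Matrix n n ℂ) :=
  nomuraPair A (schurInv A)

end JonesPair

section W

variable {n : Type*} [Fintype n] [DecidableEq n]

/-- `C = diag(c)` is an invertible diagonal matrix with `Aᵀ = C⁻² A C²`. -/
def IsSymmetrizer (A : Matrix n n ℂ) (c : n → ℂ) : Prop :=
  (∀ i, c i ≠ 0) ∧ Aᵀ = (diagonal c ^ 2)⁻¹ * A * diagonal c ^ 2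

/-- The matrix `W` with first block row `(Aᵀ, -Aᵀ)` and second block row
`(B⁽⁻⁾ᵀ C, B⁽⁻⁾ᵀ C)`, where `C = diag(c)`. -/
noncomputable def matrixW (A B : Matrix n n ℂ) (c : n → ℂ) : Matrix (n ⊕ n) (n ⊕ n) ℂ :=
  fromBlocks Aᵀ (-Aᵀ) ((schurInv B)ᵀ * diagonal c) ((schurInv B)ᵀ * diagonal c)

end W

/-- A (commutative) association scheme on a finite set `V`, given by the set of its adjacency
matrices. -/
structure IsAssociationScheme {V : Type*} [Fintype V] [DecidableEq V]
    (𝒜 : Finset (Matrix V V ℂ)) : Prop where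
  zero_one : ∀ M ∈ 𝒜, ∀ x y, M x y = 0 ∨ M x y = 1
  zero_notMem : (0 : Matrix V V ℂ) ∉ 𝒜
  one_mem : (1 : Matrix V V ℂ) ∈ 𝒜
  sum_eq : ∑ M ∈ 𝒜, M = Matrix.of fun _ _ => 1
  transpose_mem : ∀ M ∈ 𝒜, Mᵀ ∈ 𝒜
  mul_comm : ∀ M ∈ 𝒜, ∀ N ∈ 𝒜, M * N = N * M
  mul_mem_span : ∀ M ∈ 𝒜, ∀ N ∈ 𝒜, M * N ∈ Submodule.span ℂ (𝒜 : Set (Matrix V V ℂ))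

/-- `𝒜` is an association scheme and its Bose-Mesner algebra, the span of `𝒜`, is `𝒩`. Such an `𝒜`
is determined by `𝒩`: it is the basis of Schur idempotents of `𝒩`. -/
def IsSchemeOf {V : Type*} [Fintype V] [DecidableEq V] (𝒜 : Finset (Matrix V V ℂ))
    (𝒩 : Submodule ℂ (Matrix V V ℂ)) : Prop :=
  IsAssociationScheme 𝒜 ∧ Submodule.span ℂ (𝒜 : Set (Matrix V V ℂ)) = 𝒩

open Classical in
/-- The set `𝒜_Y` of the matrices `M_Y`, `M ∈ 𝒜`, obtained from the rows and the columns indexed by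
the subset `Y` of `V`, which is given by an injection into `V`. A class of `𝒜` without a pair in
`Y × Y` is dropped (its restriction is the zero matrix). -/
noncomputable def restrictScheme {V Y : Type*} (f : Y ↪ V) (𝒜 : Finset (Matrix V V ℂ)) :
    Finset (Matrix Y Y ℂ) :=
  (𝒜.image fun M => M.submatrix f f).filter fun N => N ≠ 0

/-- `ℬ` is the scheme induced by the association scheme `𝒜` on the nonempty subset `Y`. -/
def IsInducedScheme {V Y : Type*} [Fintype V] [DecidableEq V] [Fintype Y] [DecidableEq Y]
    (f : Y ↪ V) (ℬ : Finset (Matrix Y Y ℂ)) (𝒜 : Finset (Matrix V V ℂ)) : Prop :=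
  Nonempty Y ∧ IsAssociationScheme 𝒜 ∧ IsAssociationScheme ℬ ∧ restrictScheme f 𝒜 = ℬ

end JonesPairs

/-!
Write `D_j = diag(B e_j)`. The one-sided relation says that `A D_j A = D_j A D_j` for all `j`, that
is, `A ∈ N_{A,B}` with matrix of eigenvalues `B`. It makes `A⁻¹ ∘ Aᵀ` a matrix of rank one, and as
its row and column sums are `1`, all its entries are `1 / n`. So `A` is a type II matrix, and
likewise `B`; hence so is `W`. The relation also gives
`A_{li} A_{ik} A_{kl} = A_{il} A_{lk} A_{ki}`, which is the condition for `Aᵀ` to be conjugate to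
`A` by a diagonal matrix.

The Nomura algebra of a type II matrix is a Bose-Mesner algebra, and the matrices of eigenvalues of
the members of `N_{Aᵀ}` form `N_A` (Nomura, Jaeger-Matsumoto-Nomura). For `F ∈ N_A` the Schur
product of `A ∈ N_{B,A}` and `F ∈ N_{A⁽⁻⁾,A}` lies in `N_{B,A}`, and multiplying it by `A⁽⁻⁾` shows
`F ∈ N_B`; thus `N_A ⊆ N_B`. Therefore the matrix of eigenvalues of a member `M` of `N_{Aᵀ}` is also
that of a member `S` of the Nomura algebra of the lower block `(B⁽⁻⁾)ᵀ C`, and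
`diag(M, S) ∈ N_W`. Conversely, the eigenvectors in the definition of `N_W` are the pairs `(±u, v)`,
so that `u` is an eigenvector of the upper left block of every member of `N_W`. Hence these blocks
form `N_{Aᵀ} = N_A`, and the restrictions of the classes of the scheme span `N_A`.
-/

namespace JonesPairs

open Matrix

theorem diagonal_mul_diagonal_inv {n K : Type*} [Fintype n] [DecidableEq n] [Field K] {d : n → K}
    (hd : ∀ i, d i ≠ 0) : diagonal d * diagonal d⁻¹ = 1 := by
  rw [diagonal_mul_diagonal, ← diagonal_one]
  exact congrArg diagonal (funext fun i => mul_inv_cancel₀ (hd i))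

section SchurInverse

variable {m n : Type*}

theorem schurInv_schurInv (A : Matrix m n ℂ) : schurInv (schurInv A) = A := by
  ext i j
  exact inv_inv (A i j)

theorem schurInv_transpose (A : Matrix m n ℂ) : schurInv Aᵀ = (schurInv A)ᵀ := rfl

theorem schurInv_neg (A : Matrix m n ℂ) : schurInv (-A) = -schurInv A := by
  ext i j
  exact inv_neg

theorem schurInv_fromBlocks {l o : Type*} (A : Matrix n l ℂ) (B : Matrix n m ℂ)
    (C : Matrix o l ℂ) (D : Matrix o m ℂ) :
    schurInv (fromBlocks A B C D) =
      fromBlocks (schurInv A) (schurInv B) (schurInv C) (schurInv D) := by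
  ext (i | i) (j | j) <;> rfl

theorem schurInv_mul_diagonal [Fintype n] [DecidableEq n] (A : Matrix m n ℂ) (c : n → ℂ) :
    schurInv (A * diagonal c) = schurInv A * diagonal c⁻¹ := by
  ext i j
  simp only [schurInv, of_apply, mul_diagonal, Pi.inv_apply, mul_inv]

theorem IsSchurInvertible.schurInv {A : Matrix m n ℂ} (hA : IsSchurInvertible A) :
    IsSchurInvertible (schurInv A) :=
  fun i j => inv_ne_zero (hA i j)

theorem IsSchurInvertible.hadamard_hadamard_schurInv {A : Matrix m n ℂ}
    (hA : IsSchurInvertible A) (M : Matrix m n ℂ) : A ⊙ M ⊙ JonesPairs.schurInv A = M := by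
  ext i j
  rw [hadamard_apply, hadamard_apply, mul_comm (A i j)]
  exact mul_inv_cancel_right₀ (hA i j) _

end SchurInverse

section TypeII

variable {n : Type*} [Fintype n] [DecidableEq n]

/-- Type II matrices: the matrices without zero entries with `A A⁽⁻⁾ᵀ = |n| I`. They are the
matrices whose Nomura algebra is a Bose-Mesner algebra. -/
structure IsTypeII (A : Matrix n n ℂ) : Prop where
  schurInvertible : IsSchurInvertible A
  mul_transpose_schurInv : A * (schurInv A)ᵀ = (Fintype.card n : ℂ) • 1

theorem isTypeII_of_forall_card_mul_inv_apply_mul_apply {A : Matrix n n ℂ} (hA : IsUnit A)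
    (h : ∀ i j, (Fintype.card n : ℂ) * (A⁻¹ j i * A i j) = 1) : IsTypeII A := by
  refine ⟨fun i j h0 => by simpa [h0] using h i j, ?_⟩
  have hinv : (schurInv A)ᵀ = (Fintype.card n : ℂ) • A⁻¹ := by
    ext j i
    exact inv_eq_of_mul_eq_one_left ((mul_assoc _ _ _).trans (h i j))
  rw [hinv, Matrix.mul_smul, mul_nonsing_inv A ((isUnit_iff_isUnit_det A).1 hA)]

namespace IsTypeII

variable {A : Matrix n n ℂ} (hA : IsTypeII A)
include hA

theorem mul_inv_card_smul [Nonempty n] :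
    A * ((Fintype.card n : ℂ)⁻¹ • (schurInv A)ᵀ) = 1 := by
  rw [Matrix.mul_smul, hA.mul_transpose_schurInv,
    inv_smul_smul₀ (Nat.cast_ne_zero.2 Fintype.card_ne_zero)]

theorem isUnit : IsUnit A := by
  cases isEmpty_or_nonempty n
  · exact isUnit_of_subsingleton A
  · exact IsUnit.of_mul_eq_one _ hA.mul_inv_card_smul

theorem transpose_schurInv : (schurInv A)ᵀ = (Fintype.card n : ℂ) • A⁻¹ := by
  cases isEmpty_or_nonempty n
  · exact Subsingleton.elim _ _
  · rw [inv_eq_right_inv hA.mul_inv_card_smul,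
      smul_inv_smul₀ (Nat.cast_ne_zero.2 Fintype.card_ne_zero)]

theorem transpose_schurInv_mul : (schurInv A)ᵀ * A = (Fintype.card n : ℂ) • 1 := by
  rw [hA.transpose_schurInv, Matrix.smul_mul,
    nonsing_inv_mul A ((isUnit_iff_isUnit_det A).1 hA.isUnit)]

protected theorem transpose : IsTypeII Aᵀ where
  schurInvertible i j := hA.schurInvertible j i
  mul_transpose_schurInv := by
    rw [schurInv_transpose, ← transpose_mul, hA.transpose_schurInv_mul, transpose_smul,
      transpose_one]

protected theorem schurInv : IsTypeII (schurInv A) where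
  schurInvertible := hA.schurInvertible.schurInv
  mul_transpose_schurInv := by
    rw [schurInv_schurInv, ← transpose_transpose (schurInv A), ← transpose_mul,
      hA.mul_transpose_schurInv, transpose_smul, transpose_one]

protected theorem mul_diagonal {c : n → ℂ} (hc : ∀ i, c i ≠ 0) : IsTypeII (A * diagonal c) where
  schurInvertible i j := by
    rw [Matrix.mul_diagonal]
    exact mul_ne_zero (hA.schurInvertible i j) (hc j)
  mul_transpose_schurInv := by
    rw [schurInv_mul_diagonal, transpose_mul, diagonal_transpose, Matrix.mul_assoc,
      ← Matrix.mul_assoc (diagonal c), diagonal_mul_diagonal_inv hc, Matrix.one_mul,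
      hA.mul_transpose_schurInv]

theorem fromBlocks_neg {B : Matrix n n ℂ} (hB : IsTypeII B) :
    IsTypeII (fromBlocks A (-A) B B) where
  schurInvertible := by
    rintro (i | i) (j | j)
    exacts [hA.schurInvertible i j, neg_ne_zero.2 (hA.schurInvertible i j),
      hB.schurInvertible i j, hB.schurInvertible i j]
  mul_transpose_schurInv := by
    rw [schurInv_fromBlocks, schurInv_neg, fromBlocks_transpose, fromBlocks_multiply,
      transpose_neg, Matrix.neg_mul, Matrix.neg_mul, Matrix.mul_neg, Matrix.mul_neg, neg_neg,
      add_neg_cancel, add_neg_cancel, hA.mul_transpose_schurInv, hB.mul_transpose_schurInv,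
      ← add_smul, ← fromBlocks_one, fromBlocks_smul, smul_zero, Fintype.card_sum, Nat.cast_add]

end IsTypeII

end TypeII

section Eigenmatrix

variable {n : Type*} [Fintype n]

/-- `μ` is the matrix `Θ_{A,B}(M)` of eigenvalues of a member `M` of `N_{A,B}`: its `(i, j)` entry
is an eigenvalue of `M` at `A e_i ∘ B e_j`. A relation rather than a function, since the eigenvalue
at a zero vector is arbitrary. -/
def HasEigenmatrix (A B M μ : Matrix n n ℂ) : Prop :=
  ∀ i j, M *ᵥ (A.col i * B.col j) = μ i j • (A.col i * B.col j)

theorem mem_nomuraPair_iff {A B M : Matrix n n ℂ} :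
    M ∈ nomuraPair A B ↔ ∃ μ, HasEigenmatrix A B M μ := by
  refine ⟨fun h => ?_, fun ⟨μ, h⟩ i j => ⟨μ i j, h i j⟩⟩
  choose μ hμ using h
  exact ⟨μ, hμ⟩

namespace HasEigenmatrix

variable {A B M N μ ν : Matrix n n ℂ}

theorem swap (h : HasEigenmatrix A B M μ) : HasEigenmatrix B A M μᵀ := fun i j => by
  rw [mul_comm (B.col i)]
  exact h j i

theorem smul (h : HasEigenmatrix A B M μ) (r : ℂ) : HasEigenmatrix A B (r • M) (r • μ) :=
  fun i j => by rw [smul_mulVec, h i j, smul_smul, Matrix.smul_apply, smul_eq_mul]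

theorem of_col_mul_col_eq_smul {A' B' r : Matrix n n ℂ} (h : HasEigenmatrix A B M μ)
    (hr : ∀ i j, A'.col i * B'.col j = r i j • (A.col i * B.col j)) :
    HasEigenmatrix A' B' M μ := fun i j => by
  rw [hr, mulVec_smul, h i j, smul_comm]

theorem mul (hM : HasEigenmatrix A B M μ) (hN : HasEigenmatrix A B N ν) :
    HasEigenmatrix A B (M * N) (μ ⊙ ν) := fun i j => by
  rw [← mulVec_mulVec, hN i j, mulVec_smul, hM i j, smul_smul, mul_comm, hadamard_apply]

variable [DecidableEq n]

theorem scale (h : HasEigenmatrix A (schurInv A) M μ) {s : n → ℂ} (hs : ∀ i, s i ≠ 0)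
    (t : n → ℂ) :
    HasEigenmatrix (diagonal s * A * diagonal t) (schurInv (diagonal s * A * diagonal t)) M μ := by
  refine h.of_col_mul_col_eq_smul (r := of fun i j => t i * (t j)⁻¹) fun i j => funext fun k => ?_
  simp only [Pi.mul_apply, col_apply, schurInv, of_apply, mul_diagonal, diagonal_mul,
    Pi.smul_apply, smul_eq_mul]
  have := hs k
  field_simp

end HasEigenmatrix

variable [DecidableEq n]

theorem hasEigenmatrix_iff_mul_diagonal_mul {A B M μ : Matrix n n ℂ} :
    HasEigenmatrix A B M μ ↔ ∀ j, M * (diagonal (B.col j) * A) =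
      diagonal (B.col j) * A * diagonal (μ.col j) := by
  rw [HasEigenmatrix, forall_comm]
  refine forall_congr' fun j => ?_
  simp only [← Matrix.ext_iff, funext_iff]
  rw [forall_comm]
  simp [mulVec, dotProduct, Matrix.mul_apply (M := M), mul_diagonal, diagonal_mul, mul_comm]

namespace HasEigenmatrix

variable {A B C M N μ ν : Matrix n n ℂ}

theorem inv (hM : IsUnit M) (h : HasEigenmatrix A B M μ) :
    HasEigenmatrix A B M⁻¹ (schurInv μ) := fun i j => by
  have hMv := congrArg (M⁻¹ *ᵥ ·) (h i j)
  simp only [mulVec_mulVec, nonsing_inv_mul M ((isUnit_iff_isUnit_det M).1 hM), one_mulVec,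
    mulVec_smul] at hMv
  change _ = (μ i j)⁻¹ • _
  rcases eq_or_ne (μ i j) 0 with h0 | h0
  · rw [hMv, h0, zero_smul, smul_zero, mulVec_zero]
  · rw [eq_inv_smul_iff₀ h0, ← hMv]

theorem unique (hA : IsUnit A) (hB : IsSchurInvertible B) (hM : HasEigenmatrix A B M μ)
    (hN : HasEigenmatrix A B N μ) : M = N := by
  ext i j
  have hunit : IsUnit (diagonal (B.col j) * A) :=
    (IsUnit.of_mul_eq_one _ (diagonal_mul_diagonal_inv fun k => hB k j)).mul hA
  rw [hunit.mul_right_cancel ((hasEigenmatrix_iff_mul_diagonal_mul.1 hM j).trans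
    (hasEigenmatrix_iff_mul_diagonal_mul.1 hN j).symm)]

theorem transpose_schurInv (hA : IsTypeII A) (hB : IsSchurInvertible B)
    (h : HasEigenmatrix A B M μ) : HasEigenmatrix (schurInv A) (schurInv B) Mᵀ μ := by
  refine hasEigenmatrix_iff_mul_diagonal_mul.2 fun j => ?_
  set P := diagonal (B.col j) * A
  set Q := diagonal ((schurInv B).col j) * schurInv A
  set D := diagonal (μ.col j)
  have hMP : M * P = P * D := hasEigenmatrix_iff_mul_diagonal_mul.1 h j
  have hQP : Qᵀ * P = (Fintype.card n : ℂ) • 1 := by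
    have hdiag : diagonal ((schurInv B).col j) * diagonal (B.col j) = 1 :=
      mul_eq_one_comm.1 (diagonal_mul_diagonal_inv fun k => hB k j)
    rw [transpose_mul, diagonal_transpose, Matrix.mul_assoc, ← Matrix.mul_assoc _ _ A, hdiag,
      Matrix.one_mul, hA.transpose_schurInv_mul]
  have hP : IsUnit P :=
    (IsUnit.of_mul_eq_one _ (diagonal_mul_diagonal_inv fun k => hB k j)).mul hA.isUnit
  have hQM : Qᵀ * M = D * Qᵀ := hP.mul_right_cancel <| by
    rw [Matrix.mul_assoc, Matrix.mul_assoc, hMP, ← Matrix.mul_assoc Qᵀ P D, hQP, Matrix.smul_mul,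
      Matrix.one_mul, Matrix.mul_smul, Matrix.mul_one]
  simpa only [transpose_mul, transpose_transpose, D, diagonal_transpose] using
    congrArg Matrix.transpose hQM

theorem card_smul_mul_diagonal (hB : IsTypeII B) (h : HasEigenmatrix A B M μ) (i : n) :
    (Fintype.card n : ℂ) • (M * diagonal (A.col i)) =
      diagonal (A.col i) * (B * diagonal (μ i) * (schurInv B)ᵀ) := by
  have hM : M * (diagonal (A.col i) * B) = diagonal (A.col i) * B * diagonal (μ i) :=
    hasEigenmatrix_iff_mul_diagonal_mul.1 h.swap i
  calc (Fintype.card n : ℂ) • (M * diagonal (A.col i))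
      = M * (diagonal (A.col i) * B) * (schurInv B)ᵀ := by
        rw [Matrix.mul_assoc, Matrix.mul_assoc, hB.mul_transpose_schurInv, Matrix.mul_smul,
          Matrix.mul_smul, Matrix.mul_one]
    _ = diagonal (A.col i) * (B * diagonal (μ i) * (schurInv B)ᵀ) := by
        rw [hM]; simp only [Matrix.mul_assoc]

theorem card_mul_apply_mul_apply (hB : IsTypeII B) (h : HasEigenmatrix A B M μ) (i k l : n) :
    (Fintype.card n : ℂ) * (M k l * A l i) = A k i * ∑ j, B k j * μ i j * (B l j)⁻¹ := by
  have hkl := congrFun₂ (h.card_smul_mul_diagonal hB i) k l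
  rw [Matrix.smul_apply, mul_diagonal, diagonal_mul, Matrix.mul_apply] at hkl
  simp only [mul_diagonal] at hkl
  exact hkl

theorem dual (hA : IsTypeII A) (h : HasEigenmatrix A (schurInv A) M μ) :
    HasEigenmatrix (schurInv A)ᵀ Aᵀ μ ((Fintype.card n : ℂ) • M) := fun k l => funext fun i => by
  have hentry := h.card_mul_apply_mul_apply hA.schurInv i k l
  have hki := hA.schurInvertible k i
  simp only [schurInv, of_apply, inv_inv] at hentry
  simp only [mulVec, dotProduct, Pi.mul_apply, Pi.smul_apply, col_apply, transpose_apply, schurInv,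
    of_apply, Matrix.smul_apply, smul_eq_mul]
  calc ∑ j, μ i j * ((A k j)⁻¹ * A l j)
      = (A k i)⁻¹ * (A k i * ∑ j, (A k j)⁻¹ * μ i j * A l j) := by
        rw [inv_mul_cancel_left₀ hki]
        exact Finset.sum_congr rfl fun j _ => by ring
    _ = (Fintype.card n : ℂ) * M k l * ((A k i)⁻¹ * A l i) := by rw [← hentry]; ring

theorem hadamard (hB : IsTypeII B) (hM : HasEigenmatrix A B M μ)
    (hN : HasEigenmatrix (schurInv B) C N ν) :
    HasEigenmatrix A C (M ⊙ N) ((Fintype.card n : ℂ)⁻¹ • (μ * ν)) := fun i m => funext fun k => by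
  have hn : (Fintype.card n : ℂ) ≠ 0 := Nat.cast_ne_zero.2 (Fintype.card_pos_iff.2 ⟨k⟩).ne'
  have hN' (j : n) : B k j * ∑ l, N k l * ((B l j)⁻¹ * C l m) = ν j m * C k m := by
    rw [show ∑ l, N k l * ((B l j)⁻¹ * C l m) = ν j m * ((B k j)⁻¹ * C k m) from
      congrFun (hN j m) k]
    field_simp [hB.schurInvertible k j]
  rw [Matrix.smul_apply, smul_assoc, Pi.smul_apply, eq_inv_smul_iff₀ hn]
  calc (Fintype.card n : ℂ) * ∑ l, (M ⊙ N) k l * (A l i * C l m)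
      = ∑ l, (Fintype.card n : ℂ) * (M k l * A l i) * (N k l * C l m) := by
        rw [Finset.mul_sum]
        exact Finset.sum_congr rfl fun l _ => by rw [hadamard_apply]; ring
    _ = ∑ j, A k i * μ i j * (B k j * ∑ l, N k l * ((B l j)⁻¹ * C l m)) := by
        simp only [hM.card_mul_apply_mul_apply hB, Finset.mul_sum, Finset.sum_mul]
        rw [Finset.sum_comm]
        exact Finset.sum_congr rfl fun j _ => Finset.sum_congr rfl fun l _ => by ring
    _ = (μ * ν) i m * (A k i * C k m) := by
        simp only [hN', Matrix.mul_apply, Finset.sum_mul]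
        exact Finset.sum_congr rfl fun j _ => by ring

end HasEigenmatrix

end Eigenmatrix

section Nomura

variable {n : Type*} [Fintype n]

theorem nomuraPair_comm (A B : Matrix n n ℂ) : nomuraPair A B = nomuraPair B A :=
  Submodule.ext fun M => by
    change (∀ i j, _) ↔ ∀ j i, _
    rw [forall_comm]
    refine forall_congr' fun j => forall_congr' fun i => ?_
    rw [show (fun k => A k i * B k j) = fun k => B k j * A k i from funext fun k => mul_comm _ _]

theorem nomura_schurInv (A : Matrix n n ℂ) : nomura (schurInv A) = nomura A := by
  rw [nomura, schurInv_schurInv, nomuraPair_comm, nomura]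

variable [DecidableEq n]

theorem one_mem_nomuraPair (A B : Matrix n n ℂ) : 1 ∈ nomuraPair A B :=
  fun i j => ⟨1, by rw [one_mulVec, one_smul]⟩

variable {A B C M N : Matrix n n ℂ}

theorem hasEigenmatrix_allOnes (hA : IsTypeII A) :
    HasEigenmatrix A (schurInv A) (of fun _ _ => 1) ((Fintype.card n : ℂ) • 1) :=
  fun i j => funext fun k => by
  have hsum : ∑ l, A l i * (A l j)⁻¹ = ((Fintype.card n : ℂ) • (1 : Matrix n n ℂ)) j i := by
    rw [← hA.transpose_schurInv_mul, Matrix.mul_apply]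
    exact Finset.sum_congr rfl fun l _ => mul_comm _ _
  simp only [mulVec, dotProduct, Pi.mul_apply, Pi.smul_apply, col_apply, schurInv, of_apply,
    one_mul, hsum, smul_eq_mul, Matrix.smul_apply]
  rcases eq_or_ne i j with rfl | hij
  · rw [mul_inv_cancel₀ (hA.schurInvertible k i), mul_one]
  · rw [one_apply_ne hij, one_apply_ne hij.symm, mul_zero, zero_mul]

theorem hadamard_mem_nomuraPair (hB : IsTypeII B) (hM : M ∈ nomuraPair A B)
    (hN : N ∈ nomuraPair (schurInv B) C) : M ⊙ N ∈ nomuraPair A C :=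
  have ⟨_, hM⟩ := mem_nomuraPair_iff.1 hM
  have ⟨_, hN⟩ := mem_nomuraPair_iff.1 hN
  mem_nomuraPair_iff.2 ⟨_, hM.hadamard hB hN⟩

theorem transpose_mem_nomuraPair (hA : IsTypeII A) (hB : IsSchurInvertible B)
    (hM : M ∈ nomuraPair A B) : Mᵀ ∈ nomuraPair (schurInv A) (schurInv B) :=
  have ⟨_, hM⟩ := mem_nomuraPair_iff.1 hM
  mem_nomuraPair_iff.2 ⟨_, hM.transpose_schurInv hA hB⟩

theorem mul_comm_of_mem_nomuraPair (hA : IsUnit A) (hB : IsSchurInvertible B)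
    (hM : M ∈ nomuraPair A B) (hN : N ∈ nomuraPair A B) : M * N = N * M := by
  obtain ⟨μ, hM⟩ := mem_nomuraPair_iff.1 hM
  obtain ⟨ν, hN⟩ := mem_nomuraPair_iff.1 hN
  exact (hM.mul hN).unique hA hB (hadamard_comm μ ν ▸ hN.mul hM)

theorem mem_nomura_iff_exists_hasEigenmatrix_transpose (hA : IsTypeII A) :
    M ∈ nomura A ↔ ∃ F, HasEigenmatrix Aᵀ (schurInv Aᵀ) F M := by
  rw [← nomura_schurInv, nomura, schurInv_schurInv, mem_nomuraPair_iff]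
  constructor
  · rintro ⟨μ, hμ⟩
    rcases isEmpty_or_nonempty n with _ | _
    · exact ⟨0, isEmptyElim⟩
    have hdual := (HasEigenmatrix.dual hA.schurInv (by rwa [schurInv_schurInv])).smul
      (Fintype.card n : ℂ)⁻¹
    rw [schurInv_schurInv, inv_smul_smul₀ (Nat.cast_ne_zero.2 Fintype.card_ne_zero)] at hdual
    exact ⟨_, hdual⟩
  · rintro ⟨F, hF⟩
    exact ⟨_, hF.dual hA.transpose⟩

end Nomura

section FunctionAlgebra

variable {α K : Type*} [Field K] (S : Subalgebra K (α → K))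

/-- The atoms of an algebra `S` of functions: `atom S p` is the set of the points that no member
of `S` separates from `p`. -/
def atom (p : α) : Set α := {q | ∀ f ∈ S, f q = f p}

theorem self_mem_atom (p : α) : p ∈ atom S p := fun _ _ => rfl

variable {S}

theorem atom_eq_of_mem {p q : α} (h : q ∈ atom S p) : atom S q = atom S p := by
  ext x
  exact forall₂_congr fun f hf => by rw [h f hf]

theorem exists_mem_apply_eq_one_apply_eq_zero {p q : α} (h : q ∉ atom S p) :
    ∃ f ∈ S, f p = 1 ∧ f q = 0 := by
  obtain ⟨f, hf, hne⟩ : ∃ f ∈ S, f q ≠ f p := by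
    by_contra! hcon
    exact h hcon
  refine ⟨(f p - f q)⁻¹ • (f - algebraMap K _ (f q)),
    S.smul_mem (S.sub_mem hf (S.algebraMap_mem _)) _, ?_, ?_⟩
  · exact inv_mul_cancel₀ (sub_ne_zero.2 hne.symm)
  · simp

variable [Finite α]

theorem indicator_atom_mem (p : α) : (atom S p).indicator 1 ∈ S := by
  classical
  cases nonempty_fintype α
  have hsep (q : α) : ∃ f ∈ S, f p = 1 ∧ (q ∉ atom S p → f q = 0) := by
    by_cases hq : q ∈ atom S p
    · exact ⟨1, S.one_mem, rfl, fun h => absurd hq h⟩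
    · obtain ⟨f, hf, h1, h0⟩ := exists_mem_apply_eq_one_apply_eq_zero hq
      exact ⟨f, hf, h1, fun _ => h0⟩
  choose f hf h1 h0 using hsep
  convert S.prod_mem (t := Finset.univ) fun q _ => hf q using 1
  ext q
  rw [Finset.prod_apply]
  by_cases hq : q ∈ atom S p
  · rw [Set.indicator_of_mem hq, Finset.prod_eq_one fun r _ => (hq _ (hf r)).trans (h1 r),
      Pi.one_apply]
  · rw [Set.indicator_of_notMem hq]
    exact (Finset.prod_eq_zero (f := fun r => f r q) (Finset.mem_univ q) (h0 q hq)).symm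

theorem span_range_indicator_atom :
    Submodule.span K (Set.range fun p => (atom S p).indicator (1 : α → K)) =
      Subalgebra.toSubmodule S := by
  refine le_antisymm (Submodule.span_le.2 ?_) fun f hf => ?_
  · rintro _ ⟨p, rfl⟩
    exact indicator_atom_mem p
  have := Fintype.ofFinite (Set.range (atom S))
  have hsum : f = ∑ T : Set.range (atom S),
      f (Set.rangeSplitting _ T) • (T : Set α).indicator (1 : α → K) := by
    ext p
    have hT : atom S p ∈ Set.range (atom S) := ⟨p, rfl⟩
    rw [Finset.sum_apply, Fintype.sum_eq_single ⟨atom S p, hT⟩]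
    · have hp : p ∈ atom S (Set.rangeSplitting (atom S) ⟨atom S p, hT⟩) :=
        (Set.apply_rangeSplitting (atom S) _).symm ▸ self_mem_atom S p
      simp [self_mem_atom S p, hp f hf]
    · rintro ⟨_, q, rfl⟩ hne
      have hp : p ∉ atom S q := fun hp => hne (Subtype.ext (atom_eq_of_mem hp).symm)
      simp [hp]
  rw [hsum]
  refine Submodule.sum_mem _ fun T _ => Submodule.smul_mem _ _ (Submodule.subset_span ?_)
  obtain ⟨_, q, rfl⟩ := T
  exact ⟨q, rfl⟩

end FunctionAlgebra

section SchurPartition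

variable {V : Type*}

/-- A set of non-zero `01`-matrices whose supports partition the set of the pairs of points: the
part of the definition of an association scheme that does not involve matrix multiplication. -/
structure IsSchurPartition (𝒜 : Finset (Matrix V V ℂ)) : Prop where
  zero_one : ∀ M ∈ 𝒜, ∀ x y, M x y = 0 ∨ M x y = 1
  zero_notMem : (0 : Matrix V V ℂ) ∉ 𝒜
  existsUnique_one : ∀ x y, ∃! M, M ∈ 𝒜 ∧ M x y = 1

theorem IsAssociationScheme.isSchurPartition [Fintype V] [DecidableEq V]
    {𝒜 : Finset (Matrix V V ℂ)} (h : IsAssociationScheme 𝒜) : IsSchurPartition 𝒜 := by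
  classical
  refine ⟨h.zero_one, h.zero_notMem, fun x y => ?_⟩
  have hsum : ∑ M ∈ 𝒜, M x y = 1 := by
    rw [← Matrix.sum_apply, h.sum_eq, of_apply]
  have hcard : (𝒜.filter fun M => M x y = 1).card = 1 := by
    rw [← Nat.cast_inj (R := ℂ), ← Finset.sum_boole, Nat.cast_one]
    refine (Finset.sum_congr rfl fun M hM => ?_).trans hsum
    rcases h.zero_one M hM x y with h0 | h1
    · rw [if_neg fun h1 => zero_ne_one (h0.symm.trans h1), h0]
    · rw [if_pos h1, h1]
  obtain ⟨E, hE⟩ := Finset.card_eq_one.1 hcard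
  exact ⟨E, Finset.mem_filter.1 (hE ▸ Finset.mem_singleton_self E),
    fun F hF => Finset.mem_singleton.1 (hE ▸ Finset.mem_filter.2 hF)⟩

theorem exists_isSchurPartition_span_eq [Finite V] {𝒩 : Submodule ℂ (Matrix V V ℂ)}
    (hJ : (of fun _ _ => 1) ∈ 𝒩) (hS : ∀ M ∈ 𝒩, ∀ N ∈ 𝒩, M ⊙ N ∈ 𝒩) :
    ∃ 𝒜 : Finset (Matrix V V ℂ), IsSchurPartition 𝒜 ∧
      Submodule.span ℂ (𝒜 : Set (Matrix V V ℂ)) = 𝒩 := by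
  let e : (V × V → ℂ) ≃ₗ[ℂ] Matrix V V ℂ := LinearEquiv.curry ℂ ℂ V V ≪≫ₗ Matrix.ofLinearEquiv ℂ
  let S : Subalgebra ℂ (V × V → ℂ) :=
    { 𝒩.comap (e : (V × V → ℂ) →ₗ[ℂ] Matrix V V ℂ) with
      mul_mem' := fun hf hg => hS _ hf _ hg
      algebraMap_mem' := fun r => by
        have hr : e (algebraMap ℂ _ r) = r • of fun _ _ => 1 := by
          ext
          exact (mul_one r).symm
        exact 𝒩.mem_comap.2 (hr ▸ 𝒩.smul_mem r hJ) }
  let E (p : V × V) : Matrix V V ℂ := e ((atom S p).indicator 1)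
  have hE (p : V × V) (x y : V) : E p x y = 1 ↔ (x, y) ∈ atom S p :=
    Set.indicator_eq_one_iff_mem ℂ
  refine ⟨(Set.finite_range E).toFinset, ⟨?_, ?_, fun x y => ?_⟩, ?_⟩
  · simp only [Set.Finite.mem_toFinset, Set.forall_mem_range]
    exact fun p x y => Set.indicator_eq_zero_or_self _ _ _
  · rw [Set.Finite.mem_toFinset]
    rintro ⟨p, hp⟩
    have h1 := (hE p p.1 p.2).2 (self_mem_atom S p)
    rw [hp] at h1
    exact zero_ne_one h1
  · simp only [Set.Finite.mem_toFinset]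
    refine ⟨E (x, y), ⟨⟨_, rfl⟩, (hE _ x y).2 (self_mem_atom S _)⟩, ?_⟩
    rintro _ ⟨⟨p, rfl⟩, hp⟩
    simp only [E, atom_eq_of_mem ((hE p x y).1 hp)]
  · have hS𝒩 : Subalgebra.toSubmodule S = 𝒩.comap (e : (V × V → ℂ) →ₗ[ℂ] Matrix V V ℂ) := rfl
    have hrange : Set.range E = e '' Set.range fun p => (atom S p).indicator 1 :=
      Set.range_comp e _
    rw [Set.Finite.coe_toFinset, hrange, ← LinearEquiv.coe_coe, ← Submodule.map_span,
      span_range_indicator_atom, hS𝒩, Submodule.map_comap_eq_of_surjective e.surjective]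

theorem eq_of_forall_eq_one_iff {M N : Matrix V V ℂ} (hM : ∀ x y, M x y = 0 ∨ M x y = 1)
    (hN : ∀ x y, N x y = 0 ∨ N x y = 1) (h : ∀ x y, M x y = 1 ↔ N x y = 1) : M = N := by
  ext x y
  rcases hN x y with h0 | h1
  · rw [h0, (hM x y).resolve_right fun h1 => zero_ne_one (h0.symm.trans ((h x y).1 h1))]
  · rw [h1, (h x y).2 h1]

theorem mem_restrictScheme {Y : Type*} {f : Y ↪ V} {𝒜 : Finset (Matrix V V ℂ)}
    {N : Matrix Y Y ℂ} : N ∈ restrictScheme f 𝒜 ↔ (∃ M ∈ 𝒜, M.submatrix f f = N) ∧ N ≠ 0 := by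
  classical
  simp [restrictScheme]

namespace IsSchurPartition

variable {𝒜 : Finset (Matrix V V ℂ)} (h : IsSchurPartition 𝒜) {E F M : Matrix V V ℂ}
include h

theorem exists_apply_eq_one (hE : E ∈ 𝒜) : ∃ x y, E x y = 1 := by
  by_contra! hne
  have h0 : E = 0 := by
    ext x y
    exact (h.zero_one E hE x y).resolve_right (hne x y)
  exact h.zero_notMem (h0 ▸ hE)

theorem apply_eq_zero (hE : E ∈ 𝒜) (hF : F ∈ 𝒜) {x y : V} (h1 : E x y = 1) (hne : F ≠ E) :
    F x y = 0 :=
  (h.zero_one F hF x y).resolve_right fun hF1 =>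
    hne ((h.existsUnique_one x y).unique ⟨hF, hF1⟩ ⟨hE, h1⟩)

theorem apply_eq_of_mem_span (hE : E ∈ 𝒜)
    (hM : M ∈ Submodule.span ℂ (𝒜 : Set (Matrix V V ℂ))) {x y x' y' : V}
    (hxy : E x y = 1) (hxy' : E x' y' = 1) : M x y = M x' y' := by
  induction hM using Submodule.span_induction with
  | mem F hF =>
    rcases eq_or_ne F E with rfl | hne
    · rw [hxy, hxy']
    · rw [h.apply_eq_zero hE hF hxy hne, h.apply_eq_zero hE hF hxy' hne]
  | zero => rfl
  | add M N _ _ hM hN => rw [Matrix.add_apply, hM, hN, Matrix.add_apply]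
  | smul c M _ hM => rw [Matrix.smul_apply, hM, Matrix.smul_apply]

theorem sum_eq : ∑ M ∈ 𝒜, M = of fun _ _ => 1 := by
  ext x y
  obtain ⟨E, ⟨hE, h1⟩, -⟩ := h.existsUnique_one x y
  rw [Matrix.sum_apply, of_apply, ← h1]
  exact Finset.sum_eq_single_of_mem E hE fun F hF => h.apply_eq_zero hE hF h1

theorem transpose_mem (hT : ∀ M ∈ 𝒜, Mᵀ ∈ Submodule.span ℂ (𝒜 : Set (Matrix V V ℂ)))
    (hE : E ∈ 𝒜) : Eᵀ ∈ 𝒜 := by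
  obtain ⟨x, y, hxy⟩ := h.exists_apply_eq_one hE
  obtain ⟨F, ⟨hF, hyx⟩, -⟩ := h.existsUnique_one y x
  have hFE : F = Eᵀ := eq_of_forall_eq_one_iff (h.zero_one F hF) (fun a b => h.zero_one E hE b a)
    fun a b => ⟨fun hab => (h.apply_eq_of_mem_span hF (hT E hE) hab hyx).trans hxy,
      fun hab => (h.apply_eq_of_mem_span hE (hT F hF) hab hxy).trans hyx⟩
  exact hFE ▸ hF

theorem one_mem [Fintype V] [DecidableEq V] [Nonempty V]
    (h1 : 1 ∈ Submodule.span ℂ (𝒜 : Set (Matrix V V ℂ)))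
    (hJ : ∀ M ∈ 𝒜, M * (of fun _ _ => 1) = (of fun _ _ => 1) * M) : 1 ∈ 𝒜 := by
  obtain ⟨v⟩ := ‹Nonempty V›
  obtain ⟨E, ⟨hE, hv⟩, -⟩ := h.existsUnique_one v v
  have hdiag : diagonal E.diag = E := by
    ext x y
    rcases eq_or_ne x y with rfl | hne
    · rw [diagonal_apply_eq, diag_apply]
    · refine (diagonal_apply_ne _ hne).trans
        ((h.zero_one E hE x y).resolve_right fun hxy => ?_).symm
      have := h.apply_eq_of_mem_span hE h1 hxy hv
      rw [one_apply_ne hne, one_apply_eq] at this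
      exact zero_ne_one this
  have hconst (x : V) : E.diag x = 1 := by
    have := congrFun₂ (hJ E hE) x v
    rw [← hdiag, diagonal_mul, mul_diagonal] at this
    exact ((mul_one _).symm.trans this).trans ((one_mul _).trans hv)
  rwa [← hdiag, funext hconst, ← Pi.one_def, diagonal_one'] at hE

protected theorem restrictScheme {Y : Type*} (f : Y ↪ V) :
    IsSchurPartition (restrictScheme f 𝒜) where
  zero_one := by
    intro N hN x y
    obtain ⟨⟨M, hM, rfl⟩, -⟩ := mem_restrictScheme.1 hN
    exact h.zero_one M hM _ _
  zero_notMem h0 := (mem_restrictScheme.1 h0).2 rfl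
  existsUnique_one x y := by
    obtain ⟨M, ⟨hM, h1⟩, hunique⟩ := h.existsUnique_one (f x) (f y)
    refine ⟨M.submatrix f f, ⟨mem_restrictScheme.2 ⟨⟨M, hM, rfl⟩, fun h0 => ?_⟩, h1⟩, ?_⟩
    · exact one_ne_zero (h1.symm.trans (congrFun₂ h0 x y))
    · rintro _ ⟨hN', hN1⟩
      obtain ⟨⟨N, hN, rfl⟩, -⟩ := mem_restrictScheme.1 hN'
      rw [hunique N ⟨hN, hN1⟩]

end IsSchurPartition

/-- Restriction of matrices to the rows and columns in the range of `f`, as a linear map. -/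
def restrictLinear {Y : Type*} (f : Y ↪ V) : Matrix V V ℂ →ₗ[ℂ] Matrix Y Y ℂ where
  toFun M := M.submatrix f f
  map_add' _ _ := rfl
  map_smul' _ _ := rfl

theorem span_restrictScheme {Y : Type*} (f : Y ↪ V) (𝒜 : Finset (Matrix V V ℂ)) :
    Submodule.span ℂ (restrictScheme f 𝒜 : Set (Matrix Y Y ℂ)) =
      (Submodule.span ℂ (𝒜 : Set (Matrix V V ℂ))).map (restrictLinear f) := by
  have hset : (restrictScheme f 𝒜 : Set (Matrix Y Y ℂ)) = restrictLinear f '' 𝒜 \ {0} :=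
    Set.ext fun _ => mem_restrictScheme
  rw [hset, Submodule.span_sdiff_singleton_zero, Submodule.map_span]

end SchurPartition

section BoseMesner

variable {V : Type*} [Fintype V]

/-- The closure properties that characterize the Bose-Mesner algebras of association schemes. -/
structure IsBoseMesner [DecidableEq V] (𝒩 : Submodule ℂ (Matrix V V ℂ)) : Prop where
  one_mem : 1 ∈ 𝒩
  allOnes_mem : (of fun _ _ => 1) ∈ 𝒩
  hadamard_mem : ∀ M ∈ 𝒩, ∀ N ∈ 𝒩, M ⊙ N ∈ 𝒩
  transpose_mem : ∀ M ∈ 𝒩, Mᵀ ∈ 𝒩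
  mul_comm : ∀ M ∈ 𝒩, ∀ N ∈ 𝒩, M * N = N * M
  mul_mem : ∀ M ∈ 𝒩, ∀ N ∈ 𝒩, M * N ∈ 𝒩

variable [DecidableEq V]

theorem IsSchurPartition.isSchemeOf [Nonempty V] {𝒜 : Finset (Matrix V V ℂ)}
    (h : IsSchurPartition 𝒜) {𝒩 : Submodule ℂ (Matrix V V ℂ)} (h𝒩 : IsBoseMesner 𝒩)
    (hspan : Submodule.span ℂ (𝒜 : Set (Matrix V V ℂ)) = 𝒩) : IsSchemeOf 𝒜 𝒩 := by
  subst hspan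
  have hsub {M : Matrix V V ℂ} (hM : M ∈ 𝒜) : M ∈ Submodule.span ℂ (𝒜 : Set (Matrix V V ℂ)) :=
    Submodule.subset_span hM
  exact ⟨{
    zero_one := h.zero_one
    zero_notMem := h.zero_notMem
    one_mem := h.one_mem h𝒩.one_mem fun M hM => h𝒩.mul_comm M (hsub hM) _ h𝒩.allOnes_mem
    sum_eq := h.sum_eq
    transpose_mem := fun _ => h.transpose_mem fun M hM => h𝒩.transpose_mem M (hsub hM)
    mul_comm := fun M hM N hN => h𝒩.mul_comm M (hsub hM) N (hsub hN)
    mul_mem_span := fun M hM N hN => h𝒩.mul_mem M (hsub hM) N (hsub hN) }, rfl⟩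

theorem IsBoseMesner.exists_isSchemeOf [Nonempty V] {𝒩 : Submodule ℂ (Matrix V V ℂ)}
    (h : IsBoseMesner 𝒩) : ∃ 𝒜, IsSchemeOf 𝒜 𝒩 :=
  have ⟨𝒜, h𝒜, hspan⟩ := exists_isSchurPartition_span_eq h.allOnes_mem h.hadamard_mem
  ⟨𝒜, h𝒜.isSchemeOf h hspan⟩

protected theorem IsSchemeOf.restrictScheme {Y : Type*} [Fintype Y] [DecidableEq Y] [Nonempty Y]
    {𝒜 : Finset (Matrix V V ℂ)} {𝒩 : Submodule ℂ (Matrix V V ℂ)} (h : IsSchemeOf 𝒜 𝒩)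
    (f : Y ↪ V) (h𝒩 : IsBoseMesner (𝒩.map (restrictLinear f))) :
    IsSchemeOf (restrictScheme f 𝒜) (𝒩.map (restrictLinear f)) :=
  (h.1.isSchurPartition.restrictScheme f).isSchemeOf h𝒩 (by rw [span_restrictScheme, h.2])

end BoseMesner

theorem IsTypeII.isBoseMesner_nomura {V : Type*} [Fintype V] [DecidableEq V] {A : Matrix V V ℂ}
    (hA : IsTypeII A) : IsBoseMesner (nomura A) where
  one_mem := one_mem_nomuraPair _ _
  allOnes_mem := mem_nomuraPair_iff.2 ⟨_, hasEigenmatrix_allOnes hA⟩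
  hadamard_mem _ hM _ hN :=
    hadamard_mem_nomuraPair hA.schurInv hM (by rwa [schurInv_schurInv])
  transpose_mem _ hM :=
    nomura_schurInv A ▸ transpose_mem_nomuraPair hA hA.schurInvertible.schurInv hM
  mul_comm _ hM _ hN := mul_comm_of_mem_nomuraPair hA.isUnit hA.schurInvertible.schurInv hM hN
  mul_mem _ hM _ hN :=
    have ⟨_, hM⟩ := mem_nomuraPair_iff.1 hM
    have ⟨_, hN⟩ := mem_nomuraPair_iff.1 hN
    mem_nomuraPair_iff.2 ⟨_, hM.mul hN⟩

section LineSums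

variable {m n R : Type*} [Fintype n]

theorem hadamard_transpose_mulVec_one [NonAssocSemiring R] (A : Matrix m n R) (B : Matrix n m R) :
    (A ⊙ Bᵀ) *ᵥ 1 = (A * B).diag :=
  funext fun _ => Finset.sum_congr rfl fun _ _ => mul_one _

theorem one_vecMul_hadamard_transpose [CommSemiring R] (A : Matrix n m R) (B : Matrix m n R) :
    1 ᵥ* (A ⊙ Bᵀ) = (B * A).diag :=
  funext fun _ => Finset.sum_congr rfl fun _ _ => (one_mul _).trans (mul_comm _ _)

theorem card_mul_vecMulVec_apply [CommSemiring R] {a b : n → R} (hrow : vecMulVec a b *ᵥ 1 = 1)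
    (hcol : 1 ᵥ* vecMulVec a b = 1) (i j : n) :
    (Fintype.card n : R) * vecMulVec a b i j = 1 := by
  have ha (i : n) : a i * ∑ k, b k = 1 := by
    simpa [mulVec, dotProduct, vecMulVec_apply, ← Finset.mul_sum] using congrFun hrow i
  have hb (j : n) : (∑ k, a k) * b j = 1 := by
    simpa [vecMul, dotProduct, vecMulVec_apply, ← Finset.sum_mul] using congrFun hcol j
  calc (Fintype.card n : R) * vecMulVec a b i j
      = (∑ k, a k * ∑ l, b l) * (a i * b j) := by simp [ha, vecMulVec_apply]
    _ = (a i * ∑ l, b l) * ((∑ k, a k) * b j) := by rw [← Finset.sum_mul]; ring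
    _ = 1 := by rw [ha, hb, mul_one]

theorem card_mul_apply_mul_inv_apply [DecidableEq n] [CommRing R] {A A' B : Matrix n n R}
    {a : n → R} (hA : A * A' = 1) (hB : IsUnit B) (h : (A ⊙ A'ᵀ) * B = vecMulVec a 1) (i j : n) :
    (Fintype.card n : R) * (A i j * A' j i) = 1 := by
  have hrank : A ⊙ A'ᵀ = vecMulVec a (1 ᵥ* B⁻¹) := by
    rw [← vecMulVec_mul, ← h, Matrix.mul_assoc,
      mul_nonsing_inv B ((isUnit_iff_isUnit_det B).1 hB), Matrix.mul_one]
  have hrow : (A ⊙ A'ᵀ) *ᵥ 1 = 1 := by rw [hadamard_transpose_mulVec_one, hA, diag_one]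
  have hcol : 1 ᵥ* (A ⊙ A'ᵀ) = 1 := by
    rw [one_vecMul_hadamard_transpose, mul_eq_one_comm.1 hA, diag_one]
  rw [hrank] at hrow hcol
  exact (congrArg _ (congrFun₂ hrank i j)).trans (card_mul_vecMulVec_apply hrow hcol i j)

end LineSums

section OneSidedJonesPair

variable {n : Type*} [Fintype n] [DecidableEq n] {A B : Matrix n n ℂ}

omit [DecidableEq n] in
theorem IsOneSidedJonesPair.hasEigenmatrix (h : IsOneSidedJonesPair A B) :
    HasEigenmatrix A B A B := fun i j => funext fun x => by
  classical
  have hx := congrFun₂ (congrFun h (single i j 1)) x j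
  have hx : ∑ k, A x k * (B k j * A k i) = B x j * (A x i * B i j) := by
    simpa [X, Delta, Matrix.mul_apply, single_apply] using hx
  calc ∑ k, A x k * (A k i * B k j) = B x j * (A x i * B i j) := by simpa only [mul_comm] using hx
    _ = B i j * (A x i * B x j) := by ring

namespace HasEigenmatrix

variable (h : HasEigenmatrix A B A B)
include h

theorem hadamard_transpose_mul (hA : IsUnit A) (hB : IsSchurInvertible B) :
    (A⁻¹ ⊙ Aᵀ) * B = vecMulVec A.diag 1 := by
  ext l j
  have hAA : A⁻¹ * A = 1 := nonsing_inv_mul A ((isUnit_iff_isUnit_det A).1 hA)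
  have hconj : A⁻¹ * (diagonal (B.col j) * A) * diagonal (B.col j) = diagonal (B.col j) * A := by
    rw [Matrix.mul_assoc, ← hasEigenmatrix_iff_mul_diagonal_mul.1 h j, ← Matrix.mul_assoc, hAA,
      Matrix.one_mul]
  have hll := congrFun₂ hconj l l
  rw [mul_diagonal, diagonal_mul, mul_comm] at hll
  rw [vecMulVec_apply, Pi.one_apply, mul_one, diag_apply, ← mul_left_cancel₀ (hB l j) hll,
    Matrix.mul_apply, Matrix.mul_apply]
  exact Finset.sum_congr rfl fun k _ => by
    rw [hadamard_apply, diagonal_mul, transpose_apply, col_apply, mul_assoc, mul_comm (A k l)]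

theorem isTypeII_left (hA : IsUnit A) (hB : IsUnit B) (hB' : IsSchurInvertible B) : IsTypeII A :=
  isTypeII_of_forall_card_mul_inv_apply_mul_apply hA fun i j =>
    card_mul_apply_mul_inv_apply (nonsing_inv_mul A ((isUnit_iff_isUnit_det A).1 hA)) hB
      (h.hadamard_transpose_mul hA hB') j i

omit [DecidableEq n] in
theorem row_mul_col_vecMul (i l : n) :
    (A.row i * A.col l) ᵥ* B = A i l • (B.row i * B.row l) := funext fun j => by
  have hij := congrFun (h l j) i
  simp only [mulVec, vecMul, dotProduct, Pi.mul_apply, Pi.smul_apply, smul_eq_mul, row_apply,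
    col_apply] at hij ⊢
  simp only [mul_assoc, hij]
  ring

theorem hadamard_transpose_inv_mul_transpose (hA : IsSchurInvertible A) (hB : IsUnit B) :
    (B ⊙ (B⁻¹)ᵀ) * Bᵀ = vecMulVec A.diag 1 := by
  ext i l
  have hBB : B * B⁻¹ = 1 := mul_nonsing_inv B ((isUnit_iff_isUnit_det B).1 hB)
  have hrow : A.row i * A.col l = A i l • ((B.row i * B.row l) ᵥ* B⁻¹) := by
    rw [← smul_vecMul, ← h.row_mul_col_vecMul, vecMul_vecMul, hBB, vecMul_one]
  have hi : A i i * A i l = A i l * ∑ k, B i k * B l k * B⁻¹ k i := congrFun hrow i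
  rw [vecMulVec_apply, Pi.one_apply, mul_one, diag_apply,
    mul_left_cancel₀ (hA i l) ((mul_comm _ _).trans hi), Matrix.mul_apply]
  exact Finset.sum_congr rfl fun k _ => by
    rw [hadamard_apply, transpose_apply, transpose_apply, mul_right_comm]

theorem isTypeII_right (hA : IsSchurInvertible A) (hB : IsUnit B) : IsTypeII B :=
  isTypeII_of_forall_card_mul_inv_apply_mul_apply hB fun i j => by
    rw [mul_comm (B⁻¹ j i)]
    exact card_mul_apply_mul_inv_apply (mul_nonsing_inv B ((isUnit_iff_isUnit_det B).1 hB))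
      ((isUnit_transpose B).2 hB) (h.hadamard_transpose_inv_mul_transpose hA hB) i j

theorem smul_row_mul_col_comm (hB : IsUnit B) (i l : n) :
    A l i • (A.row i * A.col l) = A i l • (A.row l * A.col i) :=
  vecMul_injective_of_isUnit hB <| by
    beta_reduce
    rw [smul_vecMul, smul_vecMul, h.row_mul_col_vecMul, h.row_mul_col_vecMul, smul_smul, smul_smul,
      mul_comm (A l i), mul_comm (B.row i)]

end HasEigenmatrix

theorem isSymmetrizer_iff {c : n → ℂ} :
    IsSymmetrizer A c ↔
      (∀ i, c i ≠ 0) ∧ Aᵀ = diagonal (c ^ 2)⁻¹ * A * diagonal (c ^ 2) := by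
  refine and_congr_right fun hc => ?_
  have hc2 (i : n) : (c ^ 2) i ≠ 0 := pow_ne_zero 2 (hc i)
  rw [diagonal_pow, inv_eq_right_inv (diagonal_mul_diagonal_inv hc2)]

theorem HasEigenmatrix.exists_isSymmetrizer [Nonempty n] (h : HasEigenmatrix A B A B)
    (hA : IsSchurInvertible A) (hB : IsUnit B) : ∃ c, IsSymmetrizer A c := by
  obtain ⟨o⟩ := ‹Nonempty n›
  have hsqrt (i : n) : ∃ z : ℂ, z ^ 2 = A i o / A o i := IsAlgClosed.exists_pow_nat_eq _ two_pos
  choose c hc using hsqrt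
  have hc0 (i : n) : c i ^ 2 ≠ 0 := hc i ▸ div_ne_zero (hA i o) (hA o i)
  refine ⟨c, isSymmetrizer_iff.2 ⟨fun i => ne_zero_pow two_ne_zero (hc0 i), ?_⟩⟩
  ext i k
  have hcycle : A o i * (A i k * A k o) = A i o * (A o k * A k i) :=
    congrFun (h.smul_row_mul_col_comm hB i o) k
  have hio := hA i o
  have hok := hA o k
  simp only [mul_diagonal, diagonal_mul, transpose_apply, Pi.inv_apply, Pi.pow_apply, hc]
  field_simp
  linear_combination -hcycle

end OneSidedJonesPair

section NomuraScale

variable {n : Type*} [Fintype n] [DecidableEq n] {A B M : Matrix n n ℂ}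

theorem nomura_le_nomura_diagonal_mul_mul_diagonal {s : n → ℂ} (hs : ∀ i, s i ≠ 0) (t : n → ℂ) :
    nomura A ≤ nomura (diagonal s * A * diagonal t) := fun _ hM =>
  have ⟨_, hM⟩ := mem_nomuraPair_iff.1 hM
  mem_nomuraPair_iff.2 ⟨_, hM.scale hs t⟩

theorem IsSymmetrizer.nomura_transpose {c : n → ℂ} (hc : IsSymmetrizer A c) :
    nomura Aᵀ = nomura A := by
  obtain ⟨hc0, hAT⟩ := isSymmetrizer_iff.1 hc
  have hc2 (i : n) : (c ^ 2) i ≠ 0 := pow_ne_zero 2 (hc0 i)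
  have hA : A = diagonal (c ^ 2) * Aᵀ * diagonal (c ^ 2)⁻¹ := by
    simpa only [transpose_mul, transpose_transpose, diagonal_transpose, Matrix.mul_assoc] using
      congrArg Matrix.transpose hAT
  apply le_antisymm
  · conv_rhs => rw [hA]
    exact nomura_le_nomura_diagonal_mul_mul_diagonal hc2 _
  · conv_rhs => rw [hAT]
    exact nomura_le_nomura_diagonal_mul_mul_diagonal (fun i => inv_ne_zero (hc2 i)) _

theorem nomura_le_of_mem_nomuraPair (hA : IsTypeII A) (hB : IsSchurInvertible B)
    (hM : IsTypeII M) (h : M ∈ nomuraPair A B) : nomura A ≤ nomura B := fun F hF => by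
  have hinv : schurInv M ∈ nomuraPair (schurInv A) (schurInv B) := by
    obtain ⟨μ, hμ⟩ := mem_nomuraPair_iff.1 h
    rw [← transpose_transpose (schurInv M), hM.transpose_schurInv]
    exact transpose_mem_nomuraPair hA hB
      (mem_nomuraPair_iff.2 ⟨_, (hμ.inv hM.isUnit).smul (Fintype.card n : ℂ)⟩)
  have hMF : M ⊙ F ∈ nomuraPair B A :=
    hadamard_mem_nomuraPair hA (nomuraPair_comm A B ▸ h) (nomuraPair_comm A _ ▸ hF)
  rw [← hM.schurInvertible.hadamard_hadamard_schurInv F]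
  exact hadamard_mem_nomuraPair hA hMF hinv

end NomuraScale

section NomuraFromBlocks

variable {n : Type*} [Fintype n] {P Q M S μ : Matrix n n ℂ} {Z : Matrix (n ⊕ n) (n ⊕ n) ℂ}

/-- The vector `A e_i ∘ A⁽⁻⁾ e_j`; the Nomura algebra of `A` consists of the matrices that have all
these vectors as eigenvectors. -/
noncomputable def colRatio {m : Type*} (A : Matrix m m ℂ) (i j : m) : m → ℂ :=
  A.col i * (schurInv A).col j

theorem mem_nomura_fromBlocks_neg_iff :
    Z ∈ nomura (fromBlocks P (-P) Q Q) ↔ ∀ i j,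
      (∃ ν : ℂ, Z *ᵥ Sum.elim (colRatio P i j) (colRatio Q i j) =
        ν • Sum.elim (colRatio P i j) (colRatio Q i j)) ∧
      ∃ ν : ℂ, Z *ᵥ Sum.elim (-colRatio P i j) (colRatio Q i j) =
        ν • Sum.elim (-colRatio P i j) (colRatio Q i j) := by
  set W := fromBlocks P (-P) Q Q with hW
  have hll (i j : n) :
      colRatio W (.inl i) (.inl j) = Sum.elim (colRatio P i j) (colRatio Q i j) := by
    ext (k | k) <;> simp [hW, colRatio, schurInv]
  have hrr (i j : n) :
      colRatio W (.inr i) (.inr j) = Sum.elim (colRatio P i j) (colRatio Q i j) := by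
    ext (k | k) <;> simp [hW, colRatio, schurInv]
  have hlr (i j : n) :
      colRatio W (.inl i) (.inr j) = Sum.elim (-colRatio P i j) (colRatio Q i j) := by
    ext (k | k) <;> simp [hW, colRatio, schurInv]
  have hrl (i j : n) :
      colRatio W (.inr i) (.inl j) = Sum.elim (-colRatio P i j) (colRatio Q i j) := by
    ext (k | k) <;> simp [hW, colRatio, schurInv]
  change (∀ I J, ∃ ν : ℂ, Z *ᵥ colRatio W I J = ν • colRatio W I J) ↔ _
  simp only [Sum.forall, hll, hlr, hrl, hrr]
  grind

theorem toBlocks₁₁_mem_nomura (hZ : Z ∈ nomura (fromBlocks P (-P) Q Q)) :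
    Z.toBlocks₁₁ ∈ nomura P := fun i j => by
  change ∃ ν : ℂ, Z.toBlocks₁₁ *ᵥ colRatio P i j = ν • colRatio P i j
  obtain ⟨⟨ν, hν⟩, ν', hν'⟩ := mem_nomura_fromBlocks_neg_iff.1 hZ i j
  rw [← fromBlocks_toBlocks Z, fromBlocks_mulVec] at hν hν'
  have hplus : Z.toBlocks₁₁ *ᵥ colRatio P i j + Z.toBlocks₁₂ *ᵥ colRatio Q i j =
      ν • colRatio P i j := congrArg (· ∘ Sum.inl) hν
  have hminus : Z.toBlocks₁₁ *ᵥ (-colRatio P i j) + Z.toBlocks₁₂ *ᵥ colRatio Q i j =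
      ν' • -colRatio P i j := congrArg (· ∘ Sum.inl) hν'
  refine ⟨(ν + ν') / 2, ?_⟩
  rw [mulVec_neg] at hminus
  linear_combination (norm := module) (2 : ℂ)⁻¹ • (hplus - hminus)

theorem fromBlocks_mem_nomura (hM : HasEigenmatrix P (schurInv P) M μ)
    (hS : HasEigenmatrix Q (schurInv Q) S μ) :
    fromBlocks M 0 0 S ∈ nomura (fromBlocks P (-P) Q Q) := by
  refine mem_nomura_fromBlocks_neg_iff.2 fun i j => ?_
  have hMij : M *ᵥ colRatio P i j = μ i j • colRatio P i j := hM i j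
  have hSij : S *ᵥ colRatio Q i j = μ i j • colRatio Q i j := hS i j
  refine ⟨⟨μ i j, ?_⟩, μ i j, ?_⟩ <;> ext (k | k) <;>
    simp [fromBlocks_mulVec, mulVec_neg, hMij, hSij]

variable [DecidableEq n]

theorem map_restrictLinear_nomura_fromBlocks_neg (hP : IsTypeII P) (hQ : IsTypeII Q)
    (hle : nomura Pᵀ ≤ nomura Qᵀ) :
    (nomura (fromBlocks P (-P) Q Q)).map (restrictLinear Function.Embedding.inl) = nomura P := by
  refine le_antisymm (Submodule.map_le_iff_le_comap.2 fun Z => toBlocks₁₁_mem_nomura) fun M hM => ?_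
  obtain ⟨μ, hμ⟩ := mem_nomuraPair_iff.1 hM
  have hμP : μ ∈ nomura Pᵀ :=
    (mem_nomura_iff_exists_hasEigenmatrix_transpose hP.transpose).2 ⟨M, hμ⟩
  obtain ⟨S, hS⟩ := (mem_nomura_iff_exists_hasEigenmatrix_transpose hQ.transpose).1 (hle hμP)
  exact ⟨fromBlocks M 0 0 S, fromBlocks_mem_nomura hμ hS, rfl⟩

end NomuraFromBlocks

theorem HasEigenmatrix.map_restrictLinear_nomura_matrixW {n : Type*} [Fintype n] [DecidableEq n]
    {A B : Matrix n n ℂ} {c d : n → ℂ} (h : HasEigenmatrix A B A B) (hA : IsTypeII A)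
    (hB : IsTypeII B) (hd : IsSymmetrizer A d) (hc : ∀ i, c i ≠ 0) :
    (nomura (matrixW A B c)).map (restrictLinear Function.Embedding.inl) = nomura A := by
  have hle : nomura Aᵀᵀ ≤ nomura ((schurInv B)ᵀ * diagonal c)ᵀ :=
    calc nomura A ≤ nomura B :=
          nomura_le_of_mem_nomuraPair hA hB.schurInvertible hA (mem_nomuraPair_iff.2 ⟨B, h⟩)
      _ = nomura (schurInv B) := (nomura_schurInv B).symm
      _ ≤ nomura (diagonal c * schurInv B * diagonal 1) :=
          nomura_le_nomura_diagonal_mul_mul_diagonal hc 1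
      _ = nomura ((schurInv B)ᵀ * diagonal c)ᵀ := by
          rw [diagonal_one', Matrix.mul_one, transpose_mul, diagonal_transpose, transpose_transpose]
  rw [matrixW, map_restrictLinear_nomura_fromBlocks_neg hA.transpose
    (hB.schurInv.transpose.mul_diagonal hc) hle, hd.nomura_transpose]

end JonesPairs

theorem mainTheorem8_general {ι : Type*} [Fintype ι] [DecidableEq ι] [Nonempty ι]
    {A B : Matrix ι ι ℂ} (hAB : JonesPairs.IsOneSidedJonesPair A B) (hA : IsUnit A)
    (hB : JonesPairs.IsSchurInvertible B) (hB' : IsUnit B) :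
    (∃ c : ι → ℂ, JonesPairs.IsSymmetrizer A c) ∧
    ∀ c : ι → ℂ, (∀ i, c i ≠ 0) →
      ∃ (𝒜 : Finset (Matrix (ι ⊕ ι) (ι ⊕ ι) ℂ)) (ℬ : Finset (Matrix ι ι ℂ)),
        JonesPairs.IsSchemeOf 𝒜 (JonesPairs.nomura (JonesPairs.matrixW A B c)) ∧
        JonesPairs.IsSchemeOf ℬ (JonesPairs.nomura A) ∧
        JonesPairs.IsInducedScheme Function.Embedding.inl ℬ 𝒜 := by
  have h := hAB.hasEigenmatrix
  have hAII := h.isTypeII_left hA hB' hB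
  have hBII := h.isTypeII_right hAII.schurInvertible hB'
  obtain ⟨d, hd⟩ := h.exists_isSymmetrizer hAII.schurInvertible hB'
  refine ⟨⟨d, hd⟩, fun c hc => ?_⟩
  have hW : JonesPairs.IsTypeII (JonesPairs.matrixW A B c) :=
    hAII.transpose.fromBlocks_neg (hBII.schurInv.transpose.mul_diagonal hc)
  have hmap := h.map_restrictLinear_nomura_matrixW hAII hBII hd hc
  obtain ⟨𝒜, h𝒜⟩ := hW.isBoseMesner_nomura.exists_isSchemeOf
  have hℬ := h𝒜.restrictScheme Function.Embedding.inl (hmap ▸ hAII.isBoseMesner_nomura)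
  exact ⟨𝒜, _, h𝒜, hmap ▸ hℬ, inferInstance, h𝒜.1, hℬ.1, rfl⟩

theorem mainTheorem8 (n : ℕ) (hn : 0 < n) (A B : Matrix (Fin n) (Fin n) ℂ)
    (hAB : JonesPairs.IsInvertibleJonesPair A B) :
    (∃ c : Fin n → ℂ, JonesPairs.IsSymmetrizer A c) ∧
    ∀ c : Fin n → ℂ, JonesPairs.IsSymmetrizer A c →
      ∃ (𝒜 : Finset (Matrix (Fin n ⊕ Fin n) (Fin n ⊕ Fin n) ℂ))
        (ℬ : Finset (Matrix (Fin n) (Fin n) ℂ)),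
        JonesPairs.IsSchemeOf 𝒜 (JonesPairs.nomura (JonesPairs.matrixW A B c)) ∧
        JonesPairs.IsSchemeOf ℬ (JonesPairs.nomura A) ∧
        JonesPairs.IsInducedScheme Function.Embedding.inl ℬ 𝒜 :=
  have : NeZero n := ⟨hn.ne'⟩
  (mainTheorem8_general hAB.isJonesPair.1 hAB.isUnit_left hAB.schurInvertible_right
    hAB.isUnit_right).imp_right fun h c hc => h c hc.1
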